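/- Let $R$ be a commutative unital ring, and let $G$ be a finite simple directed graph with non-empty vertex set $V$ that is strongly connected. A vertex is a cut-vertex if removing it disconnects the underlying undirected graph. Let $G_e$ ($e\in E$) be the strong blocks of $G$, i.e. its maximal connected subgraphs without cut-vertices, and let $p_e$ be the number of vertices of $G_e$. Let $\mathcal G=\{(a_e,D^*_{G_e}):e\in E\}$ be an additive-multiplicative block-datum: $a_e\in R$, and $D^*_{G_e}$ is a $V(G_e)\times V(G_e)$ matrix over $R$ with all diagonal entries $1$. Let $J$ denote all-ones matrices. Put $D_{\mathcal G_e}:=a_e(D^*_{G_e}-J)$. The multiplicative distance matrix $D^*_G=(m_{ij})_{i,j\in V}$ and the additive-multiplicative distance matrix $D_{\mathcal G}=(d_{ij})_{i,j\in V}$ have the principal submatrices $D^*_{G_e}$ and $D_{\mathcal G_e}$, respectively, on the vertices of each block $G_e$; and for $i,j$ not in a common block, $m_{ij}:=m_{iv}m_{vj}$ and $d_{ij}:=d_{iv}+m_{iv}d_{vj}$ inductively, where $v\ne i,j$ is any cut-vertex whose removal separates $i$ from $j$ in the underlying undirected graph (the result does not depend on the choice of $v$). For a square matrix $A$ let $\operatorname{cof}(A)$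 be the sum of all its cofactors. For $v_0\in V$ define $$\kappa(D_{\mathcal G},v_0):=\det\bigl(d_{ij}-d_{iv_0}-m_{iv_0}d_{v_0j}\bigr)_{i,j\in V\setminus\{v_0\}},$$ and define $\kappa(D_{\mathcal G_e},v)$ for a vertex $v$ of $G_e$ in the same way from $D^*_{G_e}$ and $D_{\mathcal G_e}$ (a determinant of size $0$ is $1$). Then $\kappa(D_{\mathcal G},v_0)$ does not depend on $v_0\in V$, and $$\kappa(D_{\mathcal G},v_0)=\det(D^*_G)\prod_{e\in E}a_e^{p_e-1};$$ likewise $\kappa(D_{\mathcal G_e},v)=a_e^{p_e-1}\det(D^*_{G_e})$ for every block $G_e$ and every vertex $v$ of it. Writing $\kappa(D_{\mathcal G})$ and $\kappa(D_{\mathcal G_e})$ for these values, one has $$\kappa(D_{\mathcal G})=\prod_{e\in E}\kappa(D_{\mathcal G_e}),\qquad \frac{\det(D_{\mathcal G})}{\kappa(D_{\mathcal G})}=\sum_{e\in E}\frac{\det(D_{\mathcal G_e})}{\kappa(D_{\mathcal G_e})},\qquad \frac{\operatorname{cof}(D_{\mathcal G})}{\kappa(D_{\mathcal G})}-1=\sum_{e\in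 E}\Bigl(\frac{\operatorname{cof}(D_{\mathcal G_e})}{\kappa(D_{\mathcal G_e})}-1\Bigr),$$ $$\operatorname{cof}(D_{\mathcal G})=\operatorname{cof}(D^*_G)\prod_{e\in E}a_e^{p_e-1},\qquad \frac{\operatorname{cof}(D_{\mathcal G})}{\kappa(D_{\mathcal G})}=\frac{\operatorname{cof}(D^*_G)}{\det(D^*_G)}.$$ Here the denominators are placeholders: the second and third identities mean the identities in $R$ obtained by multiplying both sides by $\kappa(D_{\mathcal G})=\prod_{e}\kappa(D_{\mathcal G_e})$ and cancelling, namely $$\det(D_{\mathcal G})=\sum_{e\in E}\det(D_{\mathcal G_e})\prod_{f\ne e}\kappa(D_{\mathcal G_f}),\qquad \operatorname{cof}(D_{\mathcal G})-\kappa(D_{\mathcal G})=\sum_{e\in E}\bigl(\operatorname{cof}(D_{\mathcal G_e})-\kappa(D_{\mathcal G_e})\bigr)\prod_{f\ne e}\kappa(D_{\mathcal G_f}),$$ and the last one means $\operatorname{cof}(D_{\mathcal G})\det(D^*_G)=\operatorname{cof}(D^*_G)\,\kappa(D_{\mathcal G})$. When $\kappa(D_{\mathcal G})$ is invertible in $R$,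 so are all the denominators, and the identities between quotients hold as written. -/

import Mathlib

open scoped Matrix

/-- A vertex of a (connected) undirected graph is a *cut-vertex* if removing it disconnects
the graph. (The graph with no vertices left does not count as disconnected.) -/
def SimpleGraph.IsCutVertex {W : Type*} (H : SimpleGraph W) (v : W) : Prop :=
  ¬ (H.induce {v}ᶜ).Preconnected

/-- A simple (loopless), strongly connected directed graph: there is a directed path
between any two vertices. -/
structure StrongDigraph (V : Type*) extends Digraph V where
  loopless : ∀ v, ¬ Adj v v
  strong : ∀ u v, Relation.ReflTransGen Adj u v

namespace StrongDigraph

variable {V : Type*} (G : StrongDigraph V)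

/-- The underlying undirected graph. -/
abbrev underlying : SimpleGraph V := G.toDigraph.toSimpleGraphInclusive

/-- A *strong block* of `G`, given by its vertex set `B`: a maximal (induced) connected subgraph
without cut-vertices. (Adding edges on the same vertices never creates a cut-vertex, so a maximal
subgraph without cut-vertices is induced.) -/
def IsStrongBlock (B : Finset V) : Prop :=
  Maximal (fun B : Finset V => (G.underlying.induce (B : Set V)).Connected ∧
    ∀ v, ¬ (G.underlying.induce (B : Set V)).IsCutVertex v) B

/-- The index set `E` of the strong blocks. -/
abbrev StrongBlock : Type _ := {B : Finset V // G.IsStrongBlock B}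

noncomputable instance [Fintype V] : Fintype G.StrongBlock := Fintype.ofFinite _

/-- `v` is a cut-vertex, different from `i` and `j`, whose removal separates `i` from `j`. -/
def Separates (v i j : V) : Prop :=
  G.underlying.IsCutVertex v ∧ i ≠ v ∧ j ≠ v ∧ ∀ p : G.underlying.Walk i j, v ∈ p.support

variable {G} in
theorem underlying_reachable (i j : V) : G.underlying.Reachable i j := by
  induction G.strong i j with
  | refl => exact SimpleGraph.Reachable.refl _
  | @tail b c _ hbc ih =>
    refine ih.trans (SimpleGraph.Adj.reachable ?_)
    exact (SimpleGraph.fromRel_adj _ _ _).2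
      ⟨fun h => G.loopless c (by rwa [h] at hbc), Or.inl hbc⟩

variable {G} in
theorem Separates.dist_left_lt {v i j : V} (h : G.Separates v i j) :
    G.underlying.dist i v < G.underlying.dist i j := by
  classical
  obtain ⟨p, hp⟩ := (G.underlying_reachable i j).exists_walk_length_eq_dist
  rw [← hp]
  exact (SimpleGraph.dist_le (p.takeUntil v (h.2.2.2 p))).trans_lt
    (p.length_takeUntil_lt_length (h.2.2.2 p) h.2.2.1.symm)

variable {G} in
theorem Separates.dist_right_lt {v i j : V} (h : G.Separates v i j) :
    G.underlying.dist v j < G.underlying.dist i j := by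
  classical
  obtain ⟨p, hp⟩ := (G.underlying_reachable i j).exists_walk_length_eq_dist
  rw [← hp]
  exact (SimpleGraph.dist_le (p.dropUntil v (h.2.2.2 p))).trans_lt
    (p.length_dropUntil_lt_length (h.2.2.2 p) h.2.1.symm)

end StrongDigraph

/-- The cofactor-sum `cof A`, the sum of all the cofactors of `A`. -/
def Matrix.cofSum {n R : Type*} [Fintype n] [DecidableEq n] [CommRing R] (A : Matrix n n R) : R :=
  ∑ i, ∑ j, A.adjugate i j

/-- The invariant `κ(D, v₀)`, for the distance matrix `D` with associated multiplicative distance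
matrix `M`: the determinant of the matrix `D - u eᵀ - m wᵀ` over the vertices other than `v₀`,
where `u = D(·, v₀)`, `m = M(·, v₀)` and `wᵀ = D(v₀, ·)`. -/
def kappa {n R : Type*} [Fintype n] [DecidableEq n] [CommRing R]
    (M D : Matrix n n R) (v₀ : n) : R :=
  Matrix.det (Matrix.of fun i j : {v : n // v ≠ v₀} =>
    D i j - D i v₀ * 1 - M i v₀ * D v₀ j)

/-- An additive-multiplicative block-datum attached to `G`: for each strong block `e`, a scalar
`a e` and a square matrix `Dstar e` over the vertices of `e`, with diagonal entries `1`. -/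
structure BlockDatum {V : Type*} (G : StrongDigraph V) (R : Type*) [CommRing R] where
  a : G.StrongBlock → R
  Dstar : ∀ e : G.StrongBlock, Matrix e.1 e.1 R
  diag : ∀ (e : G.StrongBlock) (v : e.1), Dstar e v v = 1

namespace BlockDatum

variable {V : Type*} {G : StrongDigraph V} {R : Type*} [CommRing R] (𝒢 : BlockDatum G R)

/-- The matrix `a_e (D*_e - J)` of a block. -/
def blockD (e : G.StrongBlock) : Matrix e.1 e.1 R :=
  𝒢.a e • (𝒢.Dstar e - Matrix.of fun _ _ => 1)

open Classical in
/-- The entries `m i j` of the multiplicative distance matrix: the entries of `Dstar e` for two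
vertices of the same block `e`, and `m i v * m v j` for any cut-vertex `v` separating `i` from `j`
otherwise. (In a finite graph one of the first two cases always holds, and the value depends
neither on the block nor on the cut-vertex that is chosen.) -/
noncomputable def m (i j : V) : R :=
  if h : ∃ e : G.StrongBlock, i ∈ e.1 ∧ j ∈ e.1 then
    𝒢.Dstar h.choose ⟨i, h.choose_spec.1⟩ ⟨j, h.choose_spec.2⟩
  else if h : ∃ v, G.Separates v i j then
    m i h.choose * m h.choose j
  else 0
termination_by G.underlying.dist i j
decreasing_by
  · exact h.choose_spec.dist_left_lt
  · exact h.choose_spec.dist_right_lt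

open Classical in
/-- The entries `d i j` of the additive-multiplicative distance matrix: the entries of
`a_e (D*_e - J)` for two vertices of the same block `e`, and `d i v + m i v * d v j` for any
cut-vertex `v` separating `i` from `j` otherwise. -/
noncomputable def d (i j : V) : R :=
  if h : ∃ e : G.StrongBlock, i ∈ e.1 ∧ j ∈ e.1 then
    𝒢.blockD h.choose ⟨i, h.choose_spec.1⟩ ⟨j, h.choose_spec.2⟩
  else if h : ∃ v, G.Separates v i j then
    d i h.choose + 𝒢.m i h.choose * d h.choose j
  else 0
termination_by G.underlying.dist i j
decreasing_by
  · exact h.choose_spec.dist_left_lt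
  · exact h.choose_spec.dist_right_lt

/-- The multiplicative distance matrix `D*_G`. -/
noncomputable def multMatrix : Matrix V V R := Matrix.of 𝒢.m

/-- The additive-multiplicative distance matrix `D_𝒢`. -/
noncomputable def distMatrix : Matrix V V R := Matrix.of 𝒢.d

/-- The invariant `κ(D_𝒢, v₀)` of the whole graph. -/
noncomputable def kappaG [Fintype V] [DecidableEq V] (v₀ : V) : R :=
  kappa 𝒢.multMatrix 𝒢.distMatrix v₀

/-- The invariant `κ(D_{𝒢_e}, v)` of a strong block. -/
def kappaBlock [DecidableEq V] (e : G.StrongBlock) (v : e.1) : R :=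
  kappa (𝒢.Dstar e) (𝒢.blockD e) v

end BlockDatum

/-!
Cut-vertices split the graph into pieces glued along single vertices, and every quantity in the
theorem is controlled by what happens under one gluing.

*Linear algebra of one gluing.* Let `S` and `T` be vertex sets separated by their only common vertex
`v`, and let `C` be the matrix `d i j - d i v - m i v * d v j` (`Matrix.reduced`), which vanishes
for `i`, `j` on different sides of `v`. Elementary operations turn a base vertex `u ∈ S` into a
block triangular situation, so that `κ (S ∪ T, u) = κ (S, u) κ (T, v)`
(`Matrix.GluedAt.detOn_reduced`). The same operations, based at `v`, turn `D + x J` into `C`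
bordered at `v` by a row and a column. Such a determinant is linear in the border column, and
splitting that column along `S` and `T` shows that `det (D + x J) - x κ` obeys a product rule
(`Matrix.GluedAt.detOn_add_const_sub`). As `det (D + x J) = det D + x cof D`
(`Matrix.det_add_const`), the cases `x = 0` and `x = 1` yield product rules for `det D` and for
`cof D - κ`.

*Reduction to the blocks.* The recursions for `m` and `d` hold at every separating vertex, not only
at the chosen one (`BlockDatum.m_and_d_eq_of_separates`). Splitting the vertex set at separating
vertices ends at the strong blocks (`StrongDigraph.strongBlock_induction`), which gives the product
formula for `κ` and the sum formulas for `det D` and `cof D - κ`, as soon as `κ` of a block is known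
to be independent of the base vertex (`StrongDigraph.reduced_and_add_const_eq_of_glued`). This holds
because in a block the reduced matrix is `a` times a Schur complement of `M`, whence
`κ = a ^ (p - 1) det M` (`Matrix.detOn_reduced_of_eq`).

*The multiplicative matrix.* The matrix `M - J` is the distance matrix for the scalars `a = 1`. Its
`κ` is `det M`, and its determinant is `det M - cof M`; so the same formulas express `det M` and
`cof M - det M` through the blocks. Comparing them with those for `D`, where
`cof D_e = a_e ^ (p_e - 1) cof M_e`, gives `cof D = cof M ∏ a_e ^ (p_e - 1)`.
-/

/-! ### Walks inside a vertex set, and sets without cut-vertices -/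

namespace SimpleGraph

variable {V : Type*} {H : SimpleGraph V}

/-- `x` and `y` are joined by a walk of `H` all of whose vertices lie in `S`. In particular,
`H.LinkedIn {v}ᶜ x y` says that `v` does not separate `x` from `y`; it is false if `x` or `y`
is `v` itself. -/
def LinkedIn (H : SimpleGraph V) (S : Set V) (x y : V) : Prop :=
  ∃ p : H.Walk x y, ∀ z ∈ p.support, z ∈ S

namespace LinkedIn

variable {S T : Set V} {x y z : V}

theorem refl (hx : x ∈ S) : H.LinkedIn S x x := ⟨.nil, by simpa using hx⟩

theorem symm (h : H.LinkedIn S x y) : H.LinkedIn S y x := by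
  obtain ⟨p, hp⟩ := h
  exact ⟨p.reverse, by simpa using hp⟩

theorem trans (h : H.LinkedIn S x y) (h' : H.LinkedIn S y z) : H.LinkedIn S x z := by
  obtain ⟨p, hp⟩ := h
  obtain ⟨q, hq⟩ := h'
  refine ⟨p.append q, fun t ht => ?_⟩
  rcases (Walk.mem_support_append_iff p q).1 ht with ht | ht
  exacts [hp t ht, hq t ht]

theorem mono (hST : S ⊆ T) (h : H.LinkedIn S x y) : H.LinkedIn T x y :=
  h.imp fun _ hp t ht => hST (hp t ht)

theorem map {W : Type*} {K : SimpleGraph W} (f : H →g K) (h : H.LinkedIn S x y) :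
    K.LinkedIn (f '' S) (f x) (f y) := by
  obtain ⟨p, hp⟩ := h
  refine ⟨p.map f, fun z hz => ?_⟩
  rw [Walk.support_map, List.mem_map] at hz
  obtain ⟨t, ht, rfl⟩ := hz
  exact ⟨t, hp t ht, rfl⟩

end LinkedIn

theorem preconnected_induce_iff_linkedIn {S : Set V} :
    (H.induce S).Preconnected ↔ ∀ x ∈ S, ∀ y ∈ S, H.LinkedIn S x y := by
  constructor
  · intro h x hx y hy
    obtain ⟨p⟩ := h ⟨x, hx⟩ ⟨y, hy⟩
    have hp : (H.induce S).LinkedIn Set.univ ⟨x, hx⟩ ⟨y, hy⟩ := ⟨p, fun _ _ => trivial⟩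
    refine (hp.map (Embedding.induce S).toHom).mono ?_
    rintro _ ⟨t, -, rfl⟩
    exact t.2
  · rintro h ⟨x, hx⟩ ⟨y, hy⟩
    obtain ⟨p, hp⟩ := h x hx y hy
    exact ⟨p.induce S hp⟩

theorem preconnected_induce_induce_iff {S : Set V} {v : S} :
    ((H.induce S).induce {v}ᶜ).Preconnected ↔
      ∀ x ∈ S \ {v.1}, ∀ y ∈ S \ {v.1}, H.LinkedIn (S \ {v.1}) x y := by
  rw [preconnected_induce_iff_linkedIn]
  constructor
  · rintro h x ⟨hx, hxv⟩ y ⟨hy, hyv⟩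
    refine ((h ⟨x, hx⟩ (fun h => hxv (congrArg Subtype.val h)) ⟨y, hy⟩
      (fun h => hyv (congrArg Subtype.val h))).map (Embedding.induce S).toHom).mono ?_
    rintro _ ⟨t, ht, rfl⟩
    exact ⟨t.2, fun h => ht (Subtype.ext h)⟩
  · rintro h ⟨x, hx⟩ hxv ⟨y, hy⟩ hyv
    obtain ⟨p, hp⟩ := h x ⟨hx, fun h => hxv (Subtype.ext h)⟩ y ⟨hy, fun h => hyv (Subtype.ext h)⟩
    refine ⟨p.induce S fun z hz => (hp z hz).1, fun z hz => ?_⟩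
    rw [Walk.support_induce] at hz
    intro hzv
    have := List.mem_map_of_mem (f := Subtype.val) hz
    rw [List.attachWith_map_subtype_val] at this
    exact (hp _ this).2 (congrArg Subtype.val hzv)

/-- `B` induces a nonempty connected subgraph without cut-vertices (see `biconnected_iff`). For
`v ∉ B` the last clause repeats the second one. -/
def Biconnected (H : SimpleGraph V) (B : Set V) : Prop :=
  B.Nonempty ∧ (∀ x ∈ B, ∀ y ∈ B, H.LinkedIn B x y) ∧
    ∀ v, ∀ x ∈ B \ {v}, ∀ y ∈ B \ {v}, H.LinkedIn (B \ {v}) x y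

theorem biconnected_iff {B : Set V} :
    ((H.induce B).Connected ∧ ∀ v, ¬ (H.induce B).IsCutVertex v) ↔ H.Biconnected B := by
  simp only [connected_iff, IsCutVertex, not_not, preconnected_induce_induce_iff]
  rw [Biconnected, preconnected_induce_iff_linkedIn, Set.nonempty_coe_sort]
  constructor
  · rintro ⟨⟨h₁, h₂⟩, h₃⟩
    refine ⟨h₂, h₁, fun v => ?_⟩
    by_cases hv : v ∈ B
    · exact h₃ ⟨v, hv⟩
    · simpa [Set.sdiff_singleton_eq_self hv] using h₁
  · rintro ⟨h₁, h₂, h₃⟩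
    exact ⟨⟨h₂, h₁⟩, fun v => h₃ v⟩

theorem linkedIn_union {S T : Set V} (hS : ∀ x ∈ S, ∀ y ∈ S, H.LinkedIn S x y)
    (hT : ∀ x ∈ T, ∀ y ∈ T, H.LinkedIn T x y) {c : V} (hcS : c ∈ S) (hcT : c ∈ T) :
    ∀ x ∈ S ∪ T, ∀ y ∈ S ∪ T, H.LinkedIn (S ∪ T) x y := by
  have key : ∀ x ∈ S ∪ T, H.LinkedIn (S ∪ T) x c := by
    rintro x (hx | hx)
    · exact (hS x hx c hcS).mono Set.subset_union_left
    · exact (hT x hx c hcT).mono Set.subset_union_right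
  exact fun x hx y hy => (key x hx).trans (key y hy).symm

theorem Biconnected.union {S T : Set V} (hS : H.Biconnected S) (hT : H.Biconnected T) {p q : V}
    (hpq : p ≠ q) (hpS : p ∈ S) (hpT : p ∈ T) (hqS : q ∈ S) (hqT : q ∈ T) :
    H.Biconnected (S ∪ T) := by
  refine ⟨hS.1.inl, linkedIn_union hS.2.1 hT.2.1 hpS hpT, fun v => ?_⟩
  rw [Set.union_sdiff_distrib]
  -- one of the two common vertices survives the removal of `v`
  by_cases hv : p = v
  · have hq : q ∉ ({v} : Set V) := fun h => hpq (hv.trans (Eq.symm h))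
    exact linkedIn_union (hS.2.2 v) (hT.2.2 v) ⟨hqS, hq⟩ ⟨hqT, hq⟩
  · exact linkedIn_union (hS.2.2 v) (hT.2.2 v) ⟨hpS, hv⟩ ⟨hpT, hv⟩

theorem Biconnected.linkedIn_compl {B : Set V} (hB : H.Biconnected B) {v x y : V} (hx : x ∈ B)
    (hy : y ∈ B) (hxv : x ≠ v) (hyv : y ≠ v) : H.LinkedIn {v}ᶜ x y :=
  (hB.2.2 v x ⟨hx, hxv⟩ y ⟨hy, hyv⟩).mono fun _ hz => hz.2

theorem biconnected_singleton (u : V) : H.Biconnected {u} := by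
  refine ⟨⟨u, rfl⟩, ?_, fun v => ?_⟩
  · rintro _ rfl _ rfl
    exact .refl rfl
  · rintro _ ⟨rfl, hx⟩ _ ⟨rfl, -⟩
    exact .refl ⟨rfl, hx⟩

theorem Adj.biconnected_pair {u w : V} (h : H.Adj u w) : H.Biconnected {u, w} := by
  have huw : H.LinkedIn {u, w} u w := ⟨h.toWalk, by simp⟩
  refine ⟨⟨u, by simp⟩, ?_, fun v => ?_⟩
  · rintro _ (rfl | rfl) _ (rfl | rfl)
    exacts [.refl (by simp), huw, huw.symm, .refl (by simp)]
  · intro x hx y hy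
    by_cases hxy : x = y
    · subst hxy
      exact .refl hx
    -- otherwise `x`, `y` are the two vertices `u`, `w`, and `v` is neither of them
    · refine LinkedIn.mono (S := {u, w}) (fun z hz => ⟨hz, ?_⟩) ?_
      · rintro rfl
        rcases hx with ⟨rfl | rfl, hx⟩ <;> rcases hy with ⟨rfl | rfl, hy⟩ <;>
          rcases hz with rfl | rfl <;> simp_all
      · rcases hx with ⟨rfl | rfl, -⟩ <;> rcases hy with ⟨rfl | rfl, -⟩
        exacts [.refl (by simp), huw, huw.symm, .refl (by simp)]

theorem Walk.IsPath.eq_of_mem_takeUntil_of_mem_dropUntil [DecidableEq V] {i j z x : V}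
    {p : H.Walk i j} (hp : p.IsPath) (hz : z ∈ p.support) (h₁ : x ∈ (p.takeUntil z hz).support)
    (h₂ : x ∈ (p.dropUntil z hz).support) : x = z := by
  by_contra hne
  have h := hp.support_nodup
  rw [← p.take_spec hz, Walk.support_append] at h
  rw [Walk.mem_support_iff] at h₂
  exact (List.nodup_append.1 h).2.2 x h₁ x (h₂.resolve_left hne) rfl

/-- `S` contains every path of `H` between two of its vertices. -/
def PathConvex (H : SimpleGraph V) (S : Set V) : Prop :=
  ∀ ⦃i j : V⦄, i ∈ S → j ∈ S → ∀ p : H.Walk i j, p.IsPath → ∀ z ∈ p.support, z ∈ S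

theorem PathConvex.linkedIn {S : Set V} (hS : H.PathConvex S) {T : Set V} {i j : V} (hi : i ∈ S)
    (hj : j ∈ S) (h : H.LinkedIn T i j) : H.LinkedIn (S ∩ T) i j := by
  classical
  obtain ⟨p, hp⟩ := h
  exact ⟨p.bypass, fun z hz =>
    ⟨hS hi hj _ p.bypass_isPath z hz, hp z (p.support_bypass_subset_support hz)⟩⟩

/-- If `v` separates the part `S` of a path-convex set from the part `T`, a path between vertices of
`S` cannot enter `T`, since it would have to cross `v` twice. -/
theorem PathConvex.left_of_union {S T : Set V} (h : H.PathConvex (S ∪ T)) {v : V} (hv : v ∈ S)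
    (hST : ∀ i ∈ S, ∀ j ∈ T, ¬ H.LinkedIn {v}ᶜ i j) : H.PathConvex S := by
  classical
  intro i j hi hj p hp z hz
  by_contra hzS
  have hzT := (h (.inl hi) (.inl hj) p hp z hz).resolve_left hzS
  have h₁ : v ∈ (p.takeUntil z hz).support := by
    by_contra hcon
    exact hST i hi z hzT ⟨_, fun t ht htv => hcon (htv ▸ ht)⟩
  have h₂ : v ∈ (p.dropUntil z hz).support := by
    by_contra hcon
    exact hST j hj z hzT (LinkedIn.symm ⟨_, fun t ht htv => hcon (htv ▸ ht)⟩)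
  exact hzS (hp.eq_of_mem_takeUntil_of_mem_dropUntil hz h₁ h₂ ▸ hv)

end SimpleGraph

/-! ### Strong blocks and separating vertices -/

namespace StrongDigraph

variable {V : Type*} {G : StrongDigraph V}

theorem isStrongBlock_iff {B : Finset V} :
    G.IsStrongBlock B ↔ Maximal (fun B : Finset V => G.underlying.Biconnected (B : Set V)) B := by
  simp only [IsStrongBlock, SimpleGraph.biconnected_iff]

theorem StrongBlock.biconnected (e : G.StrongBlock) : G.underlying.Biconnected (e.1 : Set V) :=
  (isStrongBlock_iff.1 e.2).prop

theorem exists_strongBlock_of_biconnected [Finite V] {S : Finset V}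
    (hS : G.underlying.Biconnected (S : Set V)) : ∃ e : G.StrongBlock, S ⊆ e.1 := by
  obtain ⟨B, hSB, hB⟩ := Finite.exists_le_maximal
    (p := fun B : Finset V => G.underlying.Biconnected (B : Set V)) hS
  exact ⟨⟨B, isStrongBlock_iff.2 hB⟩, hSB⟩

theorem exists_mem_strongBlock [Finite V] (v : V) : ∃ e : G.StrongBlock, v ∈ e.1 := by
  obtain ⟨e, he⟩ := exists_strongBlock_of_biconnected (G := G) (S := {v})
    (by simpa using SimpleGraph.biconnected_singleton v)
  exact ⟨e, he (by simp)⟩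

theorem StrongBlock.eq_of_subset (e : G.StrongBlock) {S : Finset V}
    (hS : G.underlying.Biconnected (S : Set V)) (h : e.1 ⊆ S) : e.1 = S :=
  (isStrongBlock_iff.1 e.2).eq_of_le hS h

/-- Two strong blocks share at most one vertex. -/
theorem StrongBlock.eq_of_mem_of_mem (e f : G.StrongBlock) {p q : V} (hpq : p ≠ q)
    (hpe : p ∈ e.1) (hpf : p ∈ f.1) (hqe : q ∈ e.1) (hqf : q ∈ f.1) : e = f := by
  classical
  have h : G.underlying.Biconnected ((e.1 ∪ f.1 : Finset V) : Set V) := by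
    rw [Finset.coe_union]
    exact e.biconnected.union f.biconnected hpq hpe hpf hqe hqf
  exact Subtype.ext ((e.eq_of_subset h Finset.subset_union_left).trans
    (f.eq_of_subset h Finset.subset_union_right).symm)

theorem separates_iff {v i j : V} :
    G.Separates v i j ↔ i ≠ v ∧ j ≠ v ∧ ¬ G.underlying.LinkedIn {v}ᶜ i j := by
  have key : ¬ G.underlying.LinkedIn {v}ᶜ i j ↔ ∀ p : G.underlying.Walk i j, v ∈ p.support := by
    simp only [SimpleGraph.LinkedIn, not_exists, not_forall, Set.mem_compl_iff,
      Set.mem_singleton_iff, not_not, exists_prop, exists_eq_right]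
  rw [Separates, key, SimpleGraph.IsCutVertex, SimpleGraph.preconnected_induce_iff_linkedIn]
  refine ⟨fun h => h.2, fun h => ⟨fun hcon => key.2 h.2.2 (hcon i h.1 j h.2.1), h⟩⟩

theorem Separates.false_of_mem_strongBlock {v i j : V} (h : G.Separates v i j) (e : G.StrongBlock)
    (hi : i ∈ e.1) (hj : j ∈ e.1) : False := by
  rw [separates_iff] at h
  exact h.2.2 (e.biconnected.linkedIn_compl hi hj h.1 h.2.1)

/-- Two different vertices that both separate `i` from `j` occur in the same order on all paths
from `i` to `j`. -/
theorem Separates.order {u v i j : V} (hu : G.Separates u i j) (hv : G.Separates v i j)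
    (huv : u ≠ v) :
    (G.Separates v i u ∧ G.Separates u v j) ∨ (G.Separates u i v ∧ G.Separates v u j) := by
  classical
  obtain ⟨p, hp⟩ := (G.underlying_reachable i j).exists_isPath
  have hup := hu.2.2.2 p
  have hvp := hv.2.2.2 p
  simp only [separates_iff] at hu hv ⊢
  have hvp' := hvp
  rw [← p.take_spec hup, SimpleGraph.Walk.mem_support_append_iff] at hvp'
  rcases hvp' with h | h
  · left
    -- `v` comes first: the end of `p` avoids `v` from `u` on, its start avoids `u` up to `v`
    refine ⟨⟨hv.1, huv, fun hcon => hv.2.2 (hcon.trans ⟨p.dropUntil u hup, fun z hz hzv => ?_⟩)⟩,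
      huv.symm, hu.2.1, fun hcon => hu.2.2 (.trans ⟨(p.takeUntil u hup).takeUntil v h,
        fun z hz hzu => ?_⟩ hcon)⟩
    · obtain rfl : z = v := hzv
      exact huv (hp.eq_of_mem_takeUntil_of_mem_dropUntil hup h hz).symm
    · obtain rfl : z = u := hzu
      exact huv ((hp.takeUntil hup).eq_of_mem_takeUntil_of_mem_dropUntil h hz
        (SimpleGraph.Walk.end_mem_support _))
  · right
    refine ⟨⟨hu.1, huv.symm, fun hcon => hu.2.2 (hcon.trans ⟨(p.dropUntil u hup).dropUntil v h,
        fun z hz hzu => ?_⟩)⟩,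
      huv, hv.2.1, fun hcon => hv.2.2 (.trans ⟨p.takeUntil u hup, fun z hz hzv => ?_⟩ hcon)⟩
    · obtain rfl : z = u := hzu
      exact huv ((hp.dropUntil hup).eq_of_mem_takeUntil_of_mem_dropUntil h
        (SimpleGraph.Walk.start_mem_support _) hz)
    · obtain rfl : z = v := hzv
      exact huv (hp.eq_of_mem_takeUntil_of_mem_dropUntil hup hz h).symm

theorem StrongBlock.ne_singleton (e : G.StrongBlock) {v x : V} (hxv : x ≠ v) : e.1 ≠ {v} := by
  classical
  intro he
  obtain ⟨p⟩ := G.underlying_reachable v x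
  cases p with
  | nil => exact hxv rfl
  | @cons _ w _ h _ =>
    have h' : G.underlying.Biconnected (({v, w} : Finset V) : Set V) := by
      simpa using h.biconnected_pair
    have hw : w ∈ e.1 := by
      rw [e.eq_of_subset h' (by simp [he])]
      simp
    rw [he, Finset.mem_singleton] at hw
    exact h.ne hw.symm

/-- A property of vertex sets holds for the whole graph if it holds for single vertices that are no
strong blocks, for strong blocks, and passes to a union of two sets that are separated by their only
common vertex, provided that each strong block inside the union lies in exactly one of them.

The set of all vertices is split at separating vertices as long as possible. The sets `S` that arise
are path-convex and meet every strong block not contained in them in at most one vertex. Such an `S`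
that cannot be split induces a connected graph without cut-vertices, so it lies in a strong block:
it is that block or a single vertex. -/
theorem strongBlock_induction [Fintype V] [DecidableEq V] [Nonempty V] (G : StrongDigraph V)
    {P : Finset V → Prop}
    (singleton : ∀ u, (∀ e : G.StrongBlock, e.1 ≠ {u}) → P {u})
    (block : ∀ e : G.StrongBlock, P e.1)
    (glue : ∀ (S T : Finset V) (v : V), v ∈ S → v ∈ T → (∀ x ∈ S, x ∈ T → x = v) →
      (∀ i ∈ S, ∀ j ∈ T, ¬ G.underlying.LinkedIn {v}ᶜ i j) →
      (∀ e : G.StrongBlock, e.1 ⊆ S ∪ T ↔ e.1 ⊆ S ∨ e.1 ⊆ T) →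
      (∀ e : G.StrongBlock, e.1 ⊆ S → ¬ e.1 ⊆ T) → P S → P T → P (S ∪ T)) :
    P Finset.univ := by
  classical
  suffices main : ∀ S : Finset V, S.Nonempty → G.underlying.PathConvex (S : Set V) →
      (∀ e : G.StrongBlock, e.1 ⊆ S ∨ ∀ x ∈ e.1, ∀ y ∈ e.1, x ∈ S → y ∈ S → x = y) → P S from
    main _ Finset.univ_nonempty (by intro i j _ _ p _ z _; simp)
      fun e => .inl (Finset.subset_univ _)
  intro S
  induction S using Finset.strongInduction with
  | H S ih =>
  intro hne hS hB
  by_cases hcut : ∃ v ∈ S, ∃ x ∈ S, ∃ y ∈ S, x ≠ v ∧ y ≠ v ∧ ¬ G.underlying.LinkedIn {v}ᶜ x y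
  · obtain ⟨v, hv, x, hx, y, hy, hxv, hyv, hxy⟩ := hcut
    have hself : ∀ x, ¬ G.underlying.LinkedIn {v}ᶜ x v := fun x ⟨p, hp⟩ =>
      hp v p.end_mem_support rfl
    -- the part of `S` around `x`, and the rest, each with `v`
    set A := S.filter fun s => s = v ∨ G.underlying.LinkedIn {v}ᶜ x s with hA
    set B := S.filter fun s => ¬ G.underlying.LinkedIn {v}ᶜ x s with hBdef
    have hAB : A ∪ B = S := by
      ext s
      simp only [hA, hBdef, Finset.mem_union, Finset.mem_filter]
      tauto
    have hvA : v ∈ A := by simp [hA, hv]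
    have hvB : v ∈ B := by simp [hBdef, hv, hself]
    have hsep : ∀ i ∈ A, ∀ j ∈ B, ¬ G.underlying.LinkedIn {v}ᶜ i j := by
      intro i hi j hj hij
      rcases (Finset.mem_filter.1 hi).2 with rfl | hi
      · exact hself _ hij.symm
      · exact (Finset.mem_filter.1 hj).2 (hi.trans hij)
    have hsep' : ∀ i ∈ B, ∀ j ∈ A, ¬ G.underlying.LinkedIn {v}ᶜ i j :=
      fun i hi j hj hij => hsep j hj i hi hij.symm
    have hAss : A ⊂ S := by
      refine (Finset.ssubset_iff_of_subset (Finset.filter_subset _ _)).2 ⟨y, hy, fun h => ?_⟩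
      exact (Finset.mem_filter.1 h).2.elim hyv hxy
    have hBss : B ⊂ S := by
      refine (Finset.ssubset_iff_of_subset (Finset.filter_subset _ _)).2 ⟨x, hx, fun h => ?_⟩
      exact (Finset.mem_filter.1 h).2 (.refl hxv)
    have hinter : ∀ s ∈ A, s ∈ B → s = v := fun s hsA hsB =>
      (Finset.mem_filter.1 hsA).2.resolve_right (Finset.mem_filter.1 hsB).2
    have hsub : ∀ e : G.StrongBlock, e.1 ⊆ A ∪ B ↔ e.1 ⊆ A ∨ e.1 ⊆ B := by
      refine fun e => ⟨fun he => ?_, fun he => he.elim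
        (fun h => h.trans Finset.subset_union_left) (fun h => h.trans Finset.subset_union_right)⟩
      by_contra! hcon
      obtain ⟨b, hbe, hbA⟩ := Finset.not_subset.1 hcon.1
      obtain ⟨c, hce, hcB⟩ := Finset.not_subset.1 hcon.2
      refine hsep c ((Finset.mem_union.1 (he hce)).resolve_right hcB) b
        ((Finset.mem_union.1 (he hbe)).resolve_left hbA)
        (e.biconnected.linkedIn_compl hce hbe ?_ ?_)
      · rintro rfl
        exact hcB hvB
      · rintro rfl
        exact hbA hvA
    have hblock : ∀ C D : Finset V, C ∪ D = S → (∀ s ∈ C, s ∈ D → s = v) →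
        (∀ e : G.StrongBlock, e.1 ⊆ C ∪ D → e.1 ⊆ C ∨ e.1 ⊆ D) → ∀ e : G.StrongBlock,
        e.1 ⊆ C ∨ ∀ x ∈ e.1, ∀ y ∈ e.1, x ∈ C → y ∈ C → x = y := by
      intro C D hCD hint hsub e
      have hCS : C ⊆ S := hCD ▸ Finset.subset_union_left
      rcases hB e with he | he
      · rcases hsub e (by rwa [hCD]) with h | h
        · exact .inl h
        · exact .inr fun x hx y hy hxC hyC => (hint x hxC (h hx)).trans (hint y hyC (h hy)).symm
      · exact .inr fun x hx y hy hxC hyC => he x hx y hy (hCS hxC) (hCS hyC)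
    have hconv : G.underlying.PathConvex ((A : Set V) ∪ B) := by
      rwa [← Finset.coe_union, hAB]
    have hPA := ih A hAss ⟨v, hvA⟩ (hconv.left_of_union hvA hsep)
      (hblock A B hAB hinter fun e => (hsub e).1)
    have hPB := ih B hBss ⟨v, hvB⟩
      ((Set.union_comm (A : Set V) B ▸ hconv).left_of_union hvB hsep')
      (hblock B A (by rwa [Finset.union_comm]) (fun s hs hs' => hinter s hs' hs)
        fun e he => ((hsub e).1 (by rwa [Finset.union_comm])).symm)
    rw [← hAB]
    refine glue A B v hvA hvB hinter hsep hsub (fun e heA heB => ?_) hPA hPB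
    obtain ⟨z, hz⟩ := e.biconnected.1
    refine e.ne_singleton hxv ((Finset.eq_singleton_iff_nonempty_unique_mem).2
      ⟨⟨z, hz⟩, fun t ht => hinter t (heA ht) (heB ht)⟩)
  · push Not at hcut
    have hbic : G.underlying.Biconnected (S : Set V) := by
      have hall : ∀ x ∈ (S : Set V), ∀ y ∈ (S : Set V), G.underlying.LinkedIn (S : Set V) x y := by
        intro x hx y hy
        obtain ⟨p⟩ := G.underlying_reachable x y
        simpa using hS.linkedIn hx hy (T := Set.univ) ⟨p, fun _ _ => trivial⟩
      refine ⟨hne, hall, fun v x hx y hy => ?_⟩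
      by_cases hv : v ∈ S
      · exact hS.linkedIn hx.1 hy.1 (hcut v hv x hx.1 y hy.1 hx.2 hy.2)
      · rw [Set.sdiff_singleton_eq_self (by simpa using hv)]
        exact hall x hx.1 y hy.1
    obtain ⟨e, he⟩ := exists_strongBlock_of_biconnected hbic
    rcases hB e with h | h
    · rw [← h.antisymm he]
      exact block e
    · obtain ⟨u, hu⟩ := hne
      obtain rfl : S = {u} :=
        Finset.eq_singleton_iff_unique_mem.2 ⟨hu, fun t ht => h t (he ht) u (he hu) ht hu⟩
      by_cases hsingle : ∃ f : G.StrongBlock, f.1 = {u}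
      · obtain ⟨f, hf⟩ := hsingle
        rw [← hf]
        exact block f
      · exact singleton u fun f hf => hsingle ⟨f, hf⟩

end StrongDigraph

/-! ### The recursions for the entries at all separating vertices -/

namespace BlockDatum

open StrongDigraph

variable {V : Type*} {G : StrongDigraph V} {R : Type*} [CommRing R] (𝒢 : BlockDatum G R)

theorem m_eq_Dstar (e : G.StrongBlock) (i j : e.1) : 𝒢.m i j = 𝒢.Dstar e i j := by
  have h : ∃ f : G.StrongBlock, i.1 ∈ f.1 ∧ j.1 ∈ f.1 := ⟨e, i.2, j.2⟩
  rw [m, dif_pos h]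
  by_cases hij : i = j
  · subst hij
    rw [𝒢.diag, 𝒢.diag]
  · have key : ∀ (f : G.StrongBlock) (hi : i.1 ∈ f.1) (hj : j.1 ∈ f.1), f = e →
        𝒢.Dstar f ⟨i, hi⟩ ⟨j, hj⟩ = 𝒢.Dstar e i j := by
      rintro f hi hj rfl
      rfl
    exact key _ _ _ (h.choose.eq_of_mem_of_mem e (fun h => hij (Subtype.ext h))
      h.choose_spec.1 i.2 h.choose_spec.2 j.2)

theorem d_eq_blockD (e : G.StrongBlock) (i j : e.1) : 𝒢.d i j = 𝒢.blockD e i j := by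
  have h : ∃ f : G.StrongBlock, i.1 ∈ f.1 ∧ j.1 ∈ f.1 := ⟨e, i.2, j.2⟩
  rw [d, dif_pos h]
  by_cases hij : i = j
  · subst hij
    simp [blockD, 𝒢.diag]
  · have key : ∀ (f : G.StrongBlock) (hi : i.1 ∈ f.1) (hj : j.1 ∈ f.1), f = e →
        𝒢.blockD f ⟨i, hi⟩ ⟨j, hj⟩ = 𝒢.blockD e i j := by
      rintro f hi hj rfl
      rfl
    exact key _ _ _ (h.choose.eq_of_mem_of_mem e (fun h => hij (Subtype.ext h))
      h.choose_spec.1 i.2 h.choose_spec.2 j.2)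

theorem d_eq_of_mem (e : G.StrongBlock) {i j : V} (hi : i ∈ e.1) (hj : j ∈ e.1) :
    𝒢.d i j = 𝒢.a e * (𝒢.m i j - 1) := by
  rw [𝒢.d_eq_blockD e ⟨i, hi⟩ ⟨j, hj⟩, 𝒢.m_eq_Dstar e ⟨i, hi⟩ ⟨j, hj⟩]
  rfl

theorem m_self [Finite V] (v : V) : 𝒢.m v v = 1 := by
  obtain ⟨e, he⟩ := exists_mem_strongBlock (G := G) v
  rw [𝒢.m_eq_Dstar e ⟨v, he⟩ ⟨v, he⟩, 𝒢.diag]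

theorem d_self [Finite V] (v : V) : 𝒢.d v v = 0 := by
  obtain ⟨e, he⟩ := exists_mem_strongBlock (G := G) v
  rw [𝒢.d_eq_of_mem e he he, 𝒢.m_self, sub_self, mul_zero]

theorem exists_separates_and_eq {v i j : V} (h : G.Separates v i j) :
    ∃ c, G.Separates c i j ∧ 𝒢.m i j = 𝒢.m i c * 𝒢.m c j ∧
      𝒢.d i j = 𝒢.d i c + 𝒢.m i c * 𝒢.d c j := by
  have h₁ : ¬ ∃ e : G.StrongBlock, i ∈ e.1 ∧ j ∈ e.1 := fun ⟨e, hi, hj⟩ =>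
    h.false_of_mem_strongBlock e hi hj
  have h₂ : ∃ v, G.Separates v i j := ⟨v, h⟩
  refine ⟨h₂.choose, h₂.choose_spec, ?_, ?_⟩
  · rw [m, dif_neg h₁, dif_pos h₂]
  · rw [d, dif_neg h₁, dif_pos h₂]

/-- The recursions for `m` and `d` hold at every separating vertex, by induction on the distance
of `i` and `j`: of two separating vertices, each separates the other from one of `i`, `j`, and
expanding at both, in either order, gives the same result. -/
theorem m_and_d_eq_of_separates {v i j : V} (h : G.Separates v i j) :
    𝒢.m i j = 𝒢.m i v * 𝒢.m v j ∧ 𝒢.d i j = 𝒢.d i v + 𝒢.m i v * 𝒢.d v j := by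
  induction hn : G.underlying.dist i j using Nat.strong_induction_on generalizing i j v with
  | _ n ih =>
  subst hn
  obtain ⟨c, hc, hm, hd⟩ := 𝒢.exists_separates_and_eq h
  by_cases hcv : c = v
  · subst hcv
    exact ⟨hm, hd⟩
  rcases hc.order h hcv with ⟨h₁, h₂⟩ | ⟨h₁, h₂⟩
  · obtain ⟨hm₁, hd₁⟩ := ih _ hc.dist_left_lt h₁ rfl
    obtain ⟨hm₂, hd₂⟩ := ih _ h.dist_right_lt h₂ rfl
    exact ⟨by rw [hm, hm₁, hm₂]; ring, by rw [hd, hd₁, hd₂, hm₁]; ring⟩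
  · obtain ⟨hm₁, hd₁⟩ := ih _ h.dist_left_lt h₁ rfl
    obtain ⟨hm₂, hd₂⟩ := ih _ hc.dist_right_lt h₂ rfl
    exact ⟨by rw [hm, hm₁, hm₂]; ring, by rw [hd, hd₁, hd₂, hm₁]; ring⟩

/-- The recursions for `m` and `d`, including the trivial cases `v = i` and `v = j`. -/
theorem m_and_d_eq_of_not_linkedIn [Finite V] {v i j : V}
    (h : ¬ G.underlying.LinkedIn {v}ᶜ i j) :
    𝒢.m i j = 𝒢.m i v * 𝒢.m v j ∧ 𝒢.d i j = 𝒢.d i v + 𝒢.m i v * 𝒢.d v j := by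
  by_cases hi : i = v
  · subst hi
    simp [m_self, d_self]
  by_cases hj : j = v
  · subst hj
    simp [m_self, d_self]
  exact 𝒢.m_and_d_eq_of_separates (separates_iff.2 ⟨hi, hj, h⟩)

end BlockDatum

/-! ### The cofactor-sum -/

namespace Matrix

section CofactorSum

variable {n R : Type*} [Fintype n] [DecidableEq n] [CommRing R]

theorem det_eq_of_forall_col_eq_smul_add_const {A B : Matrix n n R} (c : n → R) (k : n)
    (hk : c k = 0) (h : ∀ i j, A i j = B i j + c j * B i k) : A.det = B.det := by
  rw [← det_transpose A, ← det_transpose B]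
  exact det_eq_of_forall_row_eq_smul_add_const c k hk fun i j => h j i

/-- The matrix determinant lemma for the all-ones matrix. The constant `x` is added to one column
after another; a column that has become `x` times the all-ones column clears `x` from the
others. -/
theorem det_add_const (A : Matrix n n R) (x : R) :
    (of fun i j => A i j + x).det = A.det + x * A.cofSum := by
  have key : ∀ s : Finset n, (of fun i j => A i j + if j ∈ s then x else 0).det =
      A.det + x * ∑ j ∈ s, (A.updateCol j 1).det := by
    intro s
    induction s using Finset.induction_on with
    | empty =>
      simp only [Finset.notMem_empty, if_false, add_zero, Finset.sum_empty, mul_zero]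
      rfl
    | insert k s hk ih =>
      set B : Matrix n n R := of fun i j => A i j + if j ∈ s then x else 0 with hB
      have h₁ : (of fun i j => A i j + if j ∈ insert k s then x else 0) =
          B.updateCol k ((fun i => A i k) + x • (1 : n → R)) := by
        ext i j
        by_cases hj : j = k
        · subst hj
          simp
        · simp [hB, hj]
      have h₂ : B.updateCol k (fun i => A i k) = B := by
        ext i j
        by_cases hj : j = k
        · subst hj
          simp [hB, hk]
        · rw [updateCol_ne hj]
      have h₃ : (B.updateCol k (1 : n → R)).det = (A.updateCol k 1).det := by
        refine det_eq_of_forall_col_eq_smul_add_const (fun j => if j ∈ s then x else 0) k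
          (by simp [hk]) fun i j => ?_
        by_cases hj : j = k
        · subst hj
          simp [hk]
        · simp [hB, hj]
      rw [h₁, det_updateCol_add, det_updateCol_smul, h₂, h₃, ih, Finset.sum_insert hk]
      ring
  have h := key Finset.univ
  simp only [Finset.mem_univ, if_true] at h
  rw [h, cofSum]
  congr 2
  refine Finset.sum_congr rfl fun j _ => ?_
  rw [← cramer_apply, cramer_eq_adjugate_mulVec]
  simp [mulVec, dotProduct]

theorem cofSum_sub_one (A : Matrix n n R) : (of fun i j => A i j - 1).cofSum = A.cofSum := by
  have h₁ := det_add_const A (-1)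
  have h₂ := det_add_const (of fun i j => A i j - 1) 1
  simp only [of_apply, sub_add_cancel, ← sub_eq_add_neg] at h₁ h₂
  have h₃ : (of fun i j => A i j) = A := rfl
  rw [h₃, h₁] at h₂
  linear_combination -h₂

theorem cofSum_smul (a : R) (A : Matrix n n R) :
    (a • A).cofSum = a ^ (Fintype.card n - 1) * A.cofSum := by
  simp [cofSum, adjugate_smul, Finset.mul_sum]

end CofactorSum

/-! ### Principal minors, and the reduced matrix -/

variable {V R : Type*} [DecidableEq V] [CommRing R]

/-- The principal minor of `A` on the vertices in `S`. -/
def detOn (A : Matrix V V R) (S : Finset V) : R :=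
  (A.submatrix ((↑) : S → V) (↑)).det

theorem detOn_congr {A B : Matrix V V R} {S : Finset V}
    (h : ∀ i ∈ S, ∀ j ∈ S, A i j = B i j) : A.detOn S = B.detOn S := by
  unfold detOn
  congr 1
  ext i j
  exact h i i.2 j j.2

theorem det_submatrix_eq_detOn {ι : Type*} [Fintype ι] [DecidableEq ι] (A : Matrix V V R)
    {S : Finset V} (f : ι → V) (hf : Function.Injective f) (hS : ∀ x, x ∈ S ↔ ∃ i, f i = x) :
    (A.submatrix f f).det = A.detOn S := by
  have hbij : Function.Bijective fun i => (⟨f i, (hS _).2 ⟨i, rfl⟩⟩ : S) := by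
    refine ⟨fun i j h => hf (congrArg Subtype.val h), fun ⟨x, hx⟩ => ?_⟩
    obtain ⟨i, rfl⟩ := (hS x).1 hx
    exact ⟨i, rfl⟩
  exact det_submatrix_equiv_self (Equiv.ofBijective _ hbij) (A.submatrix ((↑) : S → V) (↑))

theorem detOn_univ [Fintype V] (A : Matrix V V R) : A.detOn Finset.univ = A.det :=
  (det_submatrix_eq_detOn A id Function.injective_id (by simp)).symm

@[simp]
theorem detOn_empty (A : Matrix V V R) : A.detOn ∅ = 1 := det_isEmpty

@[simp]
theorem detOn_singleton (A : Matrix V V R) (v : V) : A.detOn {v} = A v v := by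
  rw [← det_submatrix_eq_detOn A (fun _ : Unit => v) (fun _ _ _ => rfl) (by simp [eq_comm])]
  simp

theorem detOn_smul (a : R) (A : Matrix V V R) (S : Finset V) :
    (a • A).detOn S = a ^ S.card * A.detOn S := by
  rw [detOn, submatrix_smul, Pi.smul_apply, Pi.smul_apply, det_smul, Fintype.card_coe, detOn]

theorem detOn_add_const (A : Matrix V V R) (x : R) (S : Finset V) :
    (of fun i j => A i j + x).detOn S =
      A.detOn S + x * (A.submatrix ((↑) : S → V) (↑)).cofSum :=
  det_add_const (A.submatrix ((↑) : S → V) (↑)) x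

theorem detOn_union {A : Matrix V V R} {S T : Finset V} (hST : Disjoint S T)
    (h : ∀ i ∈ T, ∀ j ∈ S, A i j = 0) : A.detOn (S ∪ T) = A.detOn S * A.detOn T := by
  rw [detOn, twoBlockTriangular_det _ (fun i : (S ∪ T : Finset V) => i.1 ∈ S)]
  · congr 1
    · refine det_submatrix_eq_detOn A (fun x : {i : (S ∪ T : Finset V) // i.1 ∈ S} => x.1.1)
        (fun x y h => Subtype.ext (Subtype.ext h)) fun x => ?_
      exact ⟨fun hx => ⟨⟨⟨x, Finset.mem_union_left _ hx⟩, hx⟩, rfl⟩, by rintro ⟨i, rfl⟩; exact i.2⟩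
    · refine det_submatrix_eq_detOn A (fun x : {i : (S ∪ T : Finset V) // i.1 ∉ S} => x.1.1)
        (fun x y h => Subtype.ext (Subtype.ext h)) fun x => ?_
      constructor
      · exact fun hx => ⟨⟨⟨x, Finset.mem_union_right _ hx⟩,
          fun h => Finset.disjoint_left.1 hST h hx⟩, rfl⟩
      · rintro ⟨i, rfl⟩
        exact (Finset.mem_union.1 i.1.2).resolve_left i.2
  · exact fun i hi j hj => h i ((Finset.mem_union.1 i.2).resolve_left hi) j hj

theorem detOn_eq_of_row {A B : Matrix V V R} {S : Finset V} {v : V} (hv : v ∈ S) (c : V → R)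
    (hc : c v = 0) (h : ∀ i ∈ S, ∀ j ∈ S, A i j = B i j + c i * B v j) :
    A.detOn S = B.detOn S :=
  det_eq_of_forall_row_eq_smul_add_const (fun i : S => c i) ⟨v, hv⟩ hc
    fun i j => h i i.2 j j.2

theorem detOn_eq_of_col {A B : Matrix V V R} {S : Finset V} {v : V} (hv : v ∈ S) (c : V → R)
    (hc : c v = 0) (h : ∀ i ∈ S, ∀ j ∈ S, A i j = B i j + c j * B i v) :
    A.detOn S = B.detOn S :=
  det_eq_of_forall_col_eq_smul_add_const (fun i : S => c i) ⟨v, hv⟩ hc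
    fun i j => h i i.2 j j.2

theorem detOn_schur {A : Matrix V V R} {S : Finset V} {v : V} (hv : v ∈ S) (h : A v v = 1) :
    A.detOn S = (of fun i j => A i j - A i v * A v j).detOn (S.erase v) := by
  -- clear the column of `v` below the diagonal entry `A v v = 1`
  set B : Matrix V V R := of fun i j => if i = v then A v j else A i j - A i v * A v j with hB
  have h₁ : A.detOn S = B.detOn S := by
    refine detOn_eq_of_row hv (fun i => if i = v then 0 else A i v) (by simp) fun i _ j _ => ?_
    by_cases hi : i = v
    · subst hi
      simp [hB]
    · simp [hB, hi]
  have h₂ : S = {v} ∪ S.erase v := by rw [← Finset.insert_eq, Finset.insert_erase hv]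
  rw [h₁]
  conv_lhs => rw [h₂]
  rw [detOn_union (by simp)]
  · rw [detOn_singleton]
    simp only [hB, of_apply, if_true, h, one_mul]
    refine detOn_congr fun i hi j _ => ?_
    simp [Finset.ne_of_mem_erase hi]
  · intro i hi j hj
    obtain rfl := Finset.mem_singleton.1 hj
    simp [hB, Finset.ne_of_mem_erase hi, h]

/-- The matrix whose determinant on `V ∖ {v}` defines `κ(D, v)`. -/
def reduced (m d : Matrix V V R) (v : V) : Matrix V V R :=
  of fun i j => d i j - d i v - m i v * d v j

theorem kappa_submatrix {ι : Type*} [Fintype ι] [DecidableEq ι] (m d : Matrix V V R)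
    {S : Finset V} (f : ι → V) (hf : Function.Injective f) (hS : ∀ x, x ∈ S ↔ ∃ i, f i = x)
    (u : ι) : kappa (m.submatrix f f) (d.submatrix f f) u =
      (reduced m d (f u)).detOn (S.erase (f u)) := by
  rw [← det_submatrix_eq_detOn _ (fun i : {w : ι // w ≠ u} => f i)
    (fun i j h => Subtype.ext (hf h))]
  · simp only [kappa, reduced, mul_one]
    rfl
  · intro x
    rw [Finset.mem_erase, hS]
    constructor
    · rintro ⟨hx, i, rfl⟩
      exact ⟨⟨i, fun h => hx (h ▸ rfl)⟩, rfl⟩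
    · rintro ⟨i, rfl⟩
      exact ⟨fun h => i.2 (hf h), i, rfl⟩

/-- If `D = a (M - J)` on `S`, the value of `κ` on `S` is `a ^ (|S| - 1) det M`, for every base
vertex: the reduced matrix is `a` times a Schur complement of `M`. -/
theorem detOn_reduced_of_eq {m d : Matrix V V R} {S : Finset V} {a : R} {u : V} (hu : u ∈ S)
    (hm : m u u = 1) (h : ∀ i ∈ S, ∀ j ∈ S, d i j = a * (m i j - 1)) :
    (reduced m d u).detOn (S.erase u) = a ^ (S.card - 1) * m.detOn S := by
  rw [detOn_schur hu hm, ← Finset.card_erase_of_mem hu, ← detOn_smul]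
  refine detOn_congr fun i hi j hj => ?_
  have hi := Finset.mem_of_mem_erase hi
  have hj := Finset.mem_of_mem_erase hj
  simp only [reduced, of_apply, smul_apply, smul_eq_mul, h i hi j hj, h i hi u hu, h u hu j hj]
  ring

/-- The matrix `reduced m d v`, bordered at `v` by the row `d v ·` and the column `c`. The entry
at `(v, v)` is `c v`. -/
def bordered (m d : Matrix V V R) (v : V) (c : V → R) : Matrix V V R :=
  of fun i j => if j = v then c i else if i = v then d v j else reduced m d v i j

theorem detOn_bordered_add (m d : Matrix V V R) {S : Finset V} {v : V} (hv : v ∈ S)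
    (c c' : V → R) : (bordered m d v (c + c')).detOn S =
      (bordered m d v c).detOn S + (bordered m d v c').detOn S := by
  have key : ∀ b : V → R, (bordered m d v b).submatrix ((↑) : S → V) (↑) =
      ((bordered m d v 0).submatrix ((↑) : S → V) (↑)).updateCol (⟨v, hv⟩ : S)
        fun i => b i := by
    intro b
    ext i j
    by_cases hj : j = ⟨v, hv⟩
    · subst hj
      simp [bordered]
    · have hj' : j.1 ≠ v := fun h => hj (Subtype.ext h)
      simp [updateCol_ne hj, bordered, hj']
  rw [detOn, detOn, detOn, key (c + c'), key c, key c']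
  exact det_updateCol_add _ _ _ _

theorem detOn_bordered_single (m d : Matrix V V R) {S : Finset V} {v : V} (hv : v ∈ S) (x : R) :
    (bordered m d v (Pi.single v x)).detOn S = x * (reduced m d v).detOn (S.erase v) := by
  have h₂ : S = {v} ∪ S.erase v := by rw [← Finset.insert_eq, Finset.insert_erase hv]
  conv_lhs => rw [h₂]
  rw [detOn_union (by simp)]
  · rw [detOn_singleton]
    congr 1
    · simp [bordered]
    · exact detOn_congr fun i hi j hj => by
        simp [bordered, Finset.ne_of_mem_erase hi, Finset.ne_of_mem_erase hj]
  · intro i hi j hj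
    obtain rfl := Finset.mem_singleton.1 hj
    simp [bordered, Finset.ne_of_mem_erase hi]

/-- Subtract `m i v` times row `v` from row `i`, then column `v` from the other columns. -/
theorem detOn_add_const_eq_bordered {m d : Matrix V V R} {S : Finset V} {v : V} (hv : v ∈ S)
    (hm : m v v = 1) (hd : d v v = 0) (x : R) :
    (of fun i j => d i j + x).detOn S =
      x * (reduced m d v).detOn (S.erase v) +
        (bordered m d v fun i => d i v + x * (1 - m i v)).detOn S := by
  rw [← detOn_bordered_single m d hv, ← detOn_bordered_add m d hv]
  set B : Matrix V V R := of fun i j =>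
    if i = v then d v j + x else d i j + x - m i v * (d v j + x) with hB
  trans B.detOn S
  · refine detOn_eq_of_row hv (fun i => if i = v then 0 else m i v) (by simp) fun i _ j _ => ?_
    by_cases hi : i = v
    · subst hi
      simp [hB]
    · simp [hB, hi]
  · refine detOn_eq_of_col hv (fun j => if j = v then 0 else 1) (by simp) fun i _ j _ => ?_
    by_cases hi : i = v <;> by_cases hj : j = v <;>
      simp [hB, bordered, reduced, hi, hj, hm, hd] <;> ring

/-! ### Gluing two matrix pairs at a vertex -/

/-- The matrices `m` and `d` on `S ∪ T` are glued from their restrictions to `S` and `T`, which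
share only the vertex `v`. -/
structure GluedAt (m d : Matrix V V R) (S T : Finset V) (v : V) : Prop where
  mem_left : v ∈ S
  mem_right : v ∈ T
  eq_of_mem : ∀ x ∈ S, x ∈ T → x = v
  m_self : m v v = 1
  d_self : d v v = 0
  m_left : ∀ i ∈ S, ∀ j ∈ T, m i j = m i v * m v j
  m_right : ∀ i ∈ T, ∀ j ∈ S, m i j = m i v * m v j
  d_left : ∀ i ∈ S, ∀ j ∈ T, d i j = d i v + m i v * d v j
  d_right : ∀ i ∈ T, ∀ j ∈ S, d i j = d i v + m i v * d v j

namespace GluedAt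

variable {m d : Matrix V V R} {S T : Finset V} {v : V}

omit [DecidableEq V] in
theorem symm (h : GluedAt m d S T v) : GluedAt m d T S v where
  mem_left := h.mem_right
  mem_right := h.mem_left
  eq_of_mem := fun x hT hS => h.eq_of_mem x hS hT
  m_self := h.m_self
  d_self := h.d_self
  m_left := h.m_right
  m_right := h.m_left
  d_left := h.d_right
  d_right := h.d_left

omit [DecidableEq V] in
theorem reduced_eq_zero (h : GluedAt m d S T v) {i j : V} (hi : i ∈ T) (hj : j ∈ S) :
    reduced m d v i j = 0 := by
  simp [reduced, h.d_right i hi j hj]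

theorem notMem_left (h : GluedAt m d S T v) {x : V} (hx : x ∈ T.erase v) : x ∉ S := fun hS =>
  Finset.ne_of_mem_erase hx (h.eq_of_mem x hS (Finset.mem_of_mem_erase hx))

theorem disjoint_erase (h : GluedAt m d S T v) : Disjoint S (T.erase v) :=
  Finset.disjoint_right.2 fun _ hx => h.notMem_left hx

theorem union_eq (h : GluedAt m d S T v) : S ∪ T = S ∪ T.erase v := by
  ext x
  have := h.mem_left
  by_cases hx : x = v
  · subst hx
    simp [this]
  · simp [hx]

/-- The value of `κ` is multiplicative under gluing, for any base vertex `u`. For `u = v` the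
reduced matrix is block diagonal; for `u ≠ v` in `S`, it becomes block triangular when `m i v` times
row `v` is subtracted from the rows `i` in `T ∖ {v}`. -/
theorem detOn_reduced (h : GluedAt m d S T v) {u : V} (hu : u ∈ S) :
    (reduced m d u).detOn ((S ∪ T).erase u) =
      (reduced m d u).detOn (S.erase u) * (reduced m d v).detOn (T.erase v) := by
  have huT : u ∉ T.erase v := fun hu' => h.notMem_left hu' hu
  have hset : (S ∪ T).erase u = S.erase u ∪ T.erase v := by
    rw [h.union_eq, Finset.erase_union_distrib, Finset.erase_eq_of_notMem huT]
  have hdisj : Disjoint (S.erase u) (T.erase v) :=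
    h.disjoint_erase.mono_left (Finset.erase_subset _ _)
  rw [hset]
  by_cases huv : u = v
  · subst huv
    exact detOn_union hdisj fun i hi j hj =>
      h.reduced_eq_zero (Finset.mem_of_mem_erase hi) (Finset.mem_of_mem_erase hj)
  · set c : V → R := fun i => if i ∈ T.erase v then m i v else 0 with hc
    set B : Matrix V V R := of fun i j => reduced m d u i j - c i * reduced m d u v j with hB
    have hcS : ∀ i ∈ S, c i = 0 := fun i hi => if_neg fun hi' => h.notMem_left hi' hi
    have hcv : c v = 0 := hcS v h.mem_left
    have hrow : ∀ i ∈ T.erase v, ∀ j, B i j = reduced m d v i j := by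
      intro i hi j
      have hiT := Finset.mem_of_mem_erase hi
      simp only [hB, hc, if_pos hi, reduced, of_apply, h.m_right i hiT u hu,
        h.d_right i hiT u hu]
      ring
    rw [detOn_eq_of_row (B := B) (Finset.mem_union_left _ (Finset.mem_erase.2 ⟨Ne.symm huv,
      h.mem_left⟩)) c hcv fun i _ j _ => by simp [hB, hcv], detOn_union hdisj]
    · congr 1
      · exact detOn_congr fun i hi j _ => by simp [hB, hcS i (Finset.mem_of_mem_erase hi)]
      · exact detOn_congr fun i hi j _ => hrow i hi j
    · intro i hi j hj
      rw [hrow i hi, h.reduced_eq_zero (Finset.mem_of_mem_erase hi) (Finset.mem_of_mem_erase hj)]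

theorem detOn_bordered_of_support (h : GluedAt m d S T v) (c : V → R)
    (hc : ∀ i ∈ T.erase v, c i = 0) : (bordered m d v c).detOn (S ∪ T) =
      (bordered m d v c).detOn S * (reduced m d v).detOn (T.erase v) := by
  rw [h.union_eq, detOn_union h.disjoint_erase]
  · congr 1
    exact detOn_congr fun i hi j hj => by
      simp [bordered, Finset.ne_of_mem_erase hi, Finset.ne_of_mem_erase hj]
  · intro i hi j hj
    by_cases hjv : j = v
    · simp [bordered, hjv, hc i hi]
    · simp [bordered, hjv, Finset.ne_of_mem_erase hi,
        h.reduced_eq_zero (Finset.mem_of_mem_erase hi) hj]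

/-- Bordered determinants with zero corner obey a product rule under gluing: the border column
splits into a part on `S` and a part on `T`. -/
theorem detOn_bordered (h : GluedAt m d S T v) (c : V → R) (hcv : c v = 0) :
    (bordered m d v c).detOn (S ∪ T) =
      (bordered m d v c).detOn S * (reduced m d v).detOn (T.erase v) +
        (reduced m d v).detOn (S.erase v) * (bordered m d v c).detOn T := by
  set c₁ : V → R := fun i => if i ∈ S then c i else 0 with hc₁
  set c₂ : V → R := fun i => if i ∈ S then 0 else c i with hc₂
  have hc : c = c₁ + c₂ := by
    ext i
    by_cases hi : i ∈ S <;> simp [hc₁, hc₂, hi]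
  have hT : ∀ i ∈ T, c₂ i = c i := by
    intro i hi
    by_cases hiS : i ∈ S
    · obtain rfl := h.eq_of_mem i hiS hi
      simp [hc₂, hcv]
    · simp [hc₂, hiS]
  have h₁ : (bordered m d v c₁).detOn S = (bordered m d v c).detOn S :=
    detOn_congr fun i hi j _ => by simp [bordered, hc₁, hi]
  have h₂ : (bordered m d v c₂).detOn T = (bordered m d v c).detOn T :=
    detOn_congr fun i hi j _ => by simp [bordered, hT i hi]
  conv_lhs => rw [hc]
  rw [detOn_bordered_add m d (Finset.mem_union_left _ h.mem_left),
    h.detOn_bordered_of_support c₁ fun i hi => if_neg (h.notMem_left hi), Finset.union_comm,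
    h.symm.detOn_bordered_of_support c₂ fun i hi => if_pos (Finset.mem_of_mem_erase hi), h₁, h₂]
  ring

/-- The product rule for `det (D + x J) - x κ`. -/
theorem detOn_add_const_sub (h : GluedAt m d S T v) (x : R) :
    (of fun i j => d i j + x).detOn (S ∪ T) - x * (reduced m d v).detOn ((S ∪ T).erase v) =
      ((of fun i j => d i j + x).detOn S - x * (reduced m d v).detOn (S.erase v)) *
          (reduced m d v).detOn (T.erase v) +
        (reduced m d v).detOn (S.erase v) *
          ((of fun i j => d i j + x).detOn T - x * (reduced m d v).detOn (T.erase v)) := by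
  simp only [detOn_add_const_eq_bordered h.mem_left h.m_self h.d_self,
    detOn_add_const_eq_bordered h.mem_right h.m_self h.d_self,
    detOn_add_const_eq_bordered (Finset.mem_union_left _ h.mem_left) h.m_self h.d_self,
    add_sub_cancel_left]
  exact h.detOn_bordered _ (by simp [h.m_self, h.d_self])

end GluedAt

end Matrix

/-! ### Product and sum formulas over the strong blocks -/

theorem Finset.sum_mul_prod_erase_union {ι R : Type*} [DecidableEq ι] [CommRing R]
    {s t : Finset ι} (h : Disjoint s t) (x k : ι → R) :
    ∑ e ∈ s ∪ t, x e * ∏ f ∈ (s ∪ t).erase e, k f =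
      (∑ e ∈ s, x e * ∏ f ∈ s.erase e, k f) * ∏ f ∈ t, k f +
        (∏ f ∈ s, k f) * ∑ e ∈ t, x e * ∏ f ∈ t.erase e, k f := by
  rw [Finset.sum_union h, Finset.sum_mul, Finset.mul_sum]
  congr 1 <;> refine Finset.sum_congr rfl fun e he => ?_
  · rw [Finset.erase_union_distrib, Finset.erase_eq_of_notMem (Finset.disjoint_left.1 h he),
      Finset.prod_union (h.mono_left (Finset.erase_subset _ _)), mul_assoc]
  · rw [Finset.erase_union_distrib, Finset.erase_eq_of_notMem (Finset.disjoint_right.1 h he),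
      Finset.prod_union (h.mono_right (Finset.erase_subset _ _))]
    ring

namespace StrongDigraph

open Matrix

/-- The formulas for `κ` and `det (D + x J) - x κ` of a matrix pair that is glued at separating
vertices, provided that `κ` of each strong block `e` has a value `k e` that does not depend on the
base vertex. Taking `x = 0` and `x = 1` gives the formulas for `det D` and `cof D - κ`. -/
theorem reduced_and_add_const_eq_of_glued {V R : Type*} [Fintype V] [DecidableEq V] [Nonempty V]
    [CommRing R] (G : StrongDigraph V) (m d : Matrix V V R) (hm : ∀ v, m v v = 1)
    (hd : ∀ v, d v v = 0)
    (hglue : ∀ v i j, ¬ G.underlying.LinkedIn {v}ᶜ i j →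
      m i j = m i v * m v j ∧ d i j = d i v + m i v * d v j)
    (k : G.StrongBlock → R)
    (hk : ∀ e : G.StrongBlock, ∀ u ∈ e.1, (reduced m d u).detOn (e.1.erase u) = k e) (x : R) :
    (∀ u, (reduced m d u).detOn (Finset.univ.erase u) = ∏ e, k e) ∧
      (of fun i j => d i j + x).detOn Finset.univ - x * ∏ e, k e =
        ∑ e : G.StrongBlock, ((of fun i j => d i j + x).detOn e.1 - x * k e) *
          ∏ f ∈ Finset.univ.erase e, k f := by
  classical
  let blocks : Finset V → Finset G.StrongBlock := fun S => Finset.univ.filter fun e => e.1 ⊆ S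
  suffices main : (∀ u ∈ Finset.univ, (reduced m d u).detOn (Finset.univ.erase u) =
      ∏ e ∈ blocks Finset.univ, k e) ∧
      (of fun i j => d i j + x).detOn Finset.univ - x * ∏ e ∈ blocks Finset.univ, k e =
        ∑ e ∈ blocks Finset.univ, ((of fun i j => d i j + x).detOn e.1 - x * k e) *
          ∏ f ∈ (blocks Finset.univ).erase e, k f by
    have huniv : blocks Finset.univ = Finset.univ := by simp [blocks]
    rw [huniv] at main
    exact ⟨fun u => main.1 u (Finset.mem_univ u), main.2⟩
  refine G.strongBlock_induction (P := fun S =>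
    (∀ u ∈ S, (reduced m d u).detOn (S.erase u) = ∏ e ∈ blocks S, k e) ∧
      (of fun i j => d i j + x).detOn S - x * ∏ e ∈ blocks S, k e =
        ∑ e ∈ blocks S, ((of fun i j => d i j + x).detOn e.1 - x * k e) *
          ∏ f ∈ (blocks S).erase e, k f) ?_ ?_ ?_
  · intro u hu
    have hblocks : blocks {u} = ∅ := by
      refine Finset.filter_eq_empty_iff.2 fun e _ he => ?_
      exact hu e (e.eq_of_subset (by simpa using SimpleGraph.biconnected_singleton u) he)
    refine ⟨fun w hw => ?_, ?_⟩
    · obtain rfl := Finset.mem_singleton.1 hw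
      simp [hblocks]
    · simp [hblocks, hd]
  · intro e
    have hblocks : blocks e.1 = {e} := by
      ext f
      rw [Finset.mem_filter, Finset.mem_singleton]
      refine ⟨fun h => Subtype.ext (f.eq_of_subset e.biconnected h.2), ?_⟩
      rintro rfl
      exact ⟨Finset.mem_univ _, subset_rfl⟩
    refine ⟨fun u hu => ?_, ?_⟩
    · rw [hblocks, Finset.prod_singleton, hk e u hu]
    · simp [hblocks]
  · rintro S T v hvS hvT hinter hsep hsub hdisj ⟨hκS, hxS⟩ ⟨hκT, hxT⟩
    have hblocks : blocks (S ∪ T) = blocks S ∪ blocks T := by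
      ext e
      simp [blocks, hsub]
    have hd' : Disjoint (blocks S) (blocks T) :=
      Finset.disjoint_left.2 fun e he he' =>
        hdisj e (Finset.mem_filter.1 he).2 (Finset.mem_filter.1 he').2
    have h : GluedAt m d S T v :=
      { mem_left := hvS
        mem_right := hvT
        eq_of_mem := hinter
        m_self := hm v
        d_self := hd v
        m_left := fun i hi j hj => (hglue v i j (hsep i hi j hj)).1
        m_right := fun i hi j hj => (hglue v i j fun hij => hsep j hj i hi hij.symm).1
        d_left := fun i hi j hj => (hglue v i j (hsep i hi j hj)).2
        d_right := fun i hi j hj => (hglue v i j fun hij => hsep j hj i hi hij.symm).2 }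
    have hκ : ∀ u ∈ S ∪ T, (reduced m d u).detOn ((S ∪ T).erase u) =
        ∏ e ∈ blocks (S ∪ T), k e := by
      intro u hu
      rw [hblocks, Finset.prod_union hd']
      rcases Finset.mem_union.1 hu with hu | hu
      · rw [h.detOn_reduced hu, hκS u hu, hκT v hvT]
      · rw [Finset.union_comm, h.symm.detOn_reduced hu, hκT u hu, hκS v hvS, mul_comm]
    refine ⟨hκ, ?_⟩
    rw [← hκ v (Finset.mem_union_left _ hvS), h.detOn_add_const_sub, hκS v hvS, hκT v hvT, hxS,
      hxT, hblocks, Finset.sum_mul_prod_erase_union hd']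

end StrongDigraph

theorem Ring.inverse_eq_of_mul_eq_one {R : Type*} [CommRing R] {a b : R} (h : a * b = 1) :
    Ring.inverse a = b := by
  have ha : IsUnit a := IsUnit.of_mul_eq_one _ h
  rw [← mul_one (Ring.inverse a), ← h, ← mul_assoc, Ring.inverse_mul_cancel a ha, one_mul]

/-- Dividing a product rule by an invertible product. -/
theorem sum_mul_prod_erase_mul_inverse {ι R : Type*} [Fintype ι] [DecidableEq ι] [CommRing R]
    (x k : ι → R) (h : IsUnit (∏ e, k e)) :
    (∑ e, x e * ∏ f ∈ Finset.univ.erase e, k f) * Ring.inverse (∏ e, k e) =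
      ∑ e, x e * Ring.inverse (k e) := by
  rw [Finset.sum_mul]
  refine Finset.sum_congr rfl fun e _ => ?_
  have he : k e * ((∏ f ∈ Finset.univ.erase e, k f) * Ring.inverse (∏ e, k e)) = 1 := by
    rw [← mul_assoc, Finset.mul_prod_erase _ _ (Finset.mem_univ e), Ring.mul_inverse_cancel _ h]
  rw [Ring.inverse_eq_of_mul_eq_one he, mul_assoc]

/-! ### The identities -/

theorem theoremA {V : Type*} [Fintype V] [DecidableEq V] {R : Type*} [CommRing R]
    (G : StrongDigraph V) (𝒢 : BlockDatum G R)
    (v₀ : V) (w : ∀ e : G.StrongBlock, e.1) :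
    -- `κ` does not depend on the base vertex, and has the stated value, on `G` and on its blocks
    (∀ v : V, 𝒢.kappaG v = 𝒢.kappaG v₀) ∧
    𝒢.kappaG v₀ = 𝒢.multMatrix.det * ∏ e : G.StrongBlock, 𝒢.a e ^ (e.1.card - 1) ∧
    (∀ (e : G.StrongBlock) (v : e.1),
      𝒢.kappaBlock e v = 𝒢.a e ^ (e.1.card - 1) * (𝒢.Dstar e).det) ∧
    -- `κ` is multiplicative over the strong blocks
    𝒢.kappaG v₀ = ∏ e : G.StrongBlock, 𝒢.kappaBlock e (w e) ∧
    -- the two additive identities, multiplied by `κ(D_𝒢) = ∏ κ(D_{𝒢_e})`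
    𝒢.distMatrix.det = ∑ e : G.StrongBlock,
      (𝒢.blockD e).det * ∏ f ∈ Finset.univ.erase e, 𝒢.kappaBlock f (w f) ∧
    𝒢.distMatrix.cofSum - 𝒢.kappaG v₀ = ∑ e : G.StrongBlock,
      ((𝒢.blockD e).cofSum - 𝒢.kappaBlock e (w e)) *
        ∏ f ∈ Finset.univ.erase e, 𝒢.kappaBlock f (w f) ∧
    -- the cofactor-sum, and the equality of its quotients, multiplied by the denominators
    𝒢.distMatrix.cofSum =
      𝒢.multMatrix.cofSum * ∏ e : G.StrongBlock, 𝒢.a e ^ (e.1.card - 1) ∧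
    𝒢.distMatrix.cofSum * 𝒢.multMatrix.det = 𝒢.multMatrix.cofSum * 𝒢.kappaG v₀ ∧
    -- the identities between quotients, when the denominators are invertible
    (IsUnit (𝒢.kappaG v₀) →
      𝒢.distMatrix.det * Ring.inverse (𝒢.kappaG v₀) =
        ∑ e : G.StrongBlock, (𝒢.blockD e).det * Ring.inverse (𝒢.kappaBlock e (w e)) ∧
      𝒢.distMatrix.cofSum * Ring.inverse (𝒢.kappaG v₀) - 1 =
        ∑ e : G.StrongBlock,
          ((𝒢.blockD e).cofSum * Ring.inverse (𝒢.kappaBlock e (w e)) - 1) ∧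
      𝒢.distMatrix.cofSum * Ring.inverse (𝒢.kappaG v₀) =
        𝒢.multMatrix.cofSum * Ring.inverse 𝒢.multMatrix.det) := by
  have : Nonempty V := ⟨v₀⟩
  -- the matrices of the blocks are submatrices of those of the graph
  have hM : ∀ e : G.StrongBlock, 𝒢.Dstar e = 𝒢.multMatrix.submatrix ((↑) : e.1 → V) (↑) :=
    fun e => by
      ext i j
      exact (𝒢.m_eq_Dstar e i j).symm
  have hD : ∀ e : G.StrongBlock, 𝒢.blockD e = 𝒢.distMatrix.submatrix ((↑) : e.1 → V) (↑) :=
    fun e => by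
      ext i j
      exact (𝒢.d_eq_blockD e i j).symm
  set M := 𝒢.multMatrix
  set D := 𝒢.distMatrix
  set α : G.StrongBlock → R := fun e => 𝒢.a e ^ (e.1.card - 1)
  have hm : ∀ v, M v v = 1 := 𝒢.m_self
  have hd : ∀ v, D v v = 0 := 𝒢.d_self
  have hdetM : ∀ e : G.StrongBlock, M.detOn e.1 = (𝒢.Dstar e).det := fun e => by rw [hM e]; rfl
  have hdetD : ∀ e : G.StrongBlock, D.detOn e.1 = (𝒢.blockD e).det := fun e => by rw [hD e]; rfl
  have hk : ∀ e : G.StrongBlock, ∀ u ∈ e.1,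
      (Matrix.reduced M D u).detOn (e.1.erase u) = α e * (𝒢.Dstar e).det := fun e u hu => by
    rw [← hdetM]
    exact Matrix.detOn_reduced_of_eq hu (hm u) fun i hi j hj => 𝒢.d_eq_of_mem e hi hj
  have hkB : ∀ (e : G.StrongBlock) (v : e.1), 𝒢.kappaBlock e v = α e * (𝒢.Dstar e).det :=
    fun e v => by
      rw [← hk e v v.2, BlockDatum.kappaBlock, hM e, hD e]
      exact Matrix.kappa_submatrix M D _ Subtype.val_injective (by simp) v
  have hkG : ∀ v, 𝒢.kappaG v = (Matrix.reduced M D v).detOn (Finset.univ.erase v) := fun v =>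
    Matrix.kappa_submatrix M D id Function.injective_id (by simp) v
  -- the formulas for `D`
  have hglue : ∀ v i j, ¬ G.underlying.LinkedIn {v}ᶜ i j →
      M i j = M i v * M v j ∧ D i j = D i v + M i v * D v j :=
    fun v i j h => 𝒢.m_and_d_eq_of_not_linkedIn h
  have main := fun x => G.reduced_and_add_const_eq_of_glued M D hm hd hglue _ hk x
  -- the formulas for `M - J`, the distance matrix for `a = 1`
  have main₁ := G.reduced_and_add_const_eq_of_glued M (Matrix.of fun i j => M i j - 1) hm
    (fun v => by simp [hm])
    (fun v i j h => ⟨(hglue v i j h).1, by simp only [Matrix.of_apply, (hglue v i j h).1]; ring⟩)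
    (fun e => (𝒢.Dstar e).det)
    (fun e u hu => by
      rw [Matrix.detOn_reduced_of_eq (a := 1) hu (hm u) (by simp), one_pow, one_mul, hdetM]) 0
  have hκ : ∀ v, 𝒢.kappaG v = ∏ e, α e * (𝒢.Dstar e).det := fun v => by
    rw [hkG, (main 0).1 v]
  have hprodM : M.det = ∏ e : G.StrongBlock, (𝒢.Dstar e).det := by
    rw [← main₁.1 v₀, Matrix.detOn_reduced_of_eq (a := 1) (Finset.mem_univ v₀) (hm v₀) (by simp),
      one_pow, one_mul, Matrix.detOn_univ]
  have hdet : D.det = ∑ e : G.StrongBlock,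
      (𝒢.blockD e).det * ∏ f ∈ Finset.univ.erase e, α f * (𝒢.Dstar f).det := by
    have h := (main 0).2
    simp only [add_zero, zero_mul, sub_zero] at h
    rw [← Matrix.detOn_univ]
    refine Eq.trans h (Finset.sum_congr rfl fun e _ => ?_)
    rw [← hdetD]
    rfl
  have hcof : D.cofSum - ∏ e, α e * (𝒢.Dstar e).det = ∑ e : G.StrongBlock,
      ((𝒢.blockD e).cofSum - α e * (𝒢.Dstar e).det) *
        ∏ f ∈ Finset.univ.erase e, α f * (𝒢.Dstar f).det := by
    have h := (main 1).2
    simp only [one_mul, Matrix.detOn_univ, Matrix.det_add_const, Matrix.detOn_add_const,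
      ← hD, hdetD] at h
    rw [hdet, add_sub_assoc, ← eq_sub_iff_add_eq', ← Finset.sum_sub_distrib] at h
    rw [h]
    exact Finset.sum_congr rfl fun e _ => by ring
  -- `det (M - J) = det M - cof M`, so the formula for `det` of `M - J` is one for `cof M - det M`
  have hcofM : M.cofSum - M.det = ∑ e : G.StrongBlock,
      ((𝒢.Dstar e).cofSum - (𝒢.Dstar e).det) *
        ∏ f ∈ Finset.univ.erase e, (𝒢.Dstar f).det := by
    have h := main₁.2
    have hJ : (Matrix.of fun i j => (Matrix.of fun i j => M i j - 1 : Matrix V V R) i j + 0) =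
        Matrix.of fun i j => M i j + -1 := by
      ext i j
      simp [sub_eq_add_neg]
    rw [hJ] at h
    simp only [Matrix.detOn_univ, Matrix.det_add_const, Matrix.detOn_add_const,
      ← hM, hdetM, zero_mul, sub_zero] at h
    rw [← neg_inj, ← Finset.sum_neg_distrib]
    trans M.det + -1 * M.cofSum
    · ring
    · exact h.trans (Finset.sum_congr rfl fun e _ => by ring)
  have hcofB : ∀ e, (𝒢.blockD e).cofSum = α e * (𝒢.Dstar e).cofSum := fun e => by
    have h : 𝒢.blockD e = 𝒢.a e • Matrix.of fun i j => 𝒢.Dstar e i j - 1 := rfl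
    rw [h, Matrix.cofSum_smul, Matrix.cofSum_sub_one, Fintype.card_coe]
  have hcofG : D.cofSum = M.cofSum * ∏ e, α e := by
    have h : D.cofSum - ∏ e, α e * (𝒢.Dstar e).det = (M.cofSum - M.det) * ∏ e, α e := by
      rw [hcof, hcofM, Finset.sum_mul]
      refine Finset.sum_congr rfl fun e _ => ?_
      rw [hcofB, Finset.prod_mul_distrib, ← Finset.mul_prod_erase _ α (Finset.mem_univ e)]
      ring
    rw [Finset.prod_mul_distrib, ← hprodM] at h
    linear_combination h
  simp only [hκ, hkB]
  refine ⟨fun _ => trivial, ?_, fun _ _ => rfl, trivial, hdet, hcof, hcofG, ?_,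
    fun hu => ⟨?_, ?_, ?_⟩⟩
  · rw [Finset.prod_mul_distrib, hprodM, mul_comm]
  · rw [hcofG, Finset.prod_mul_distrib, hprodM]
    ring
  · rw [hdet, sum_mul_prod_erase_mul_inverse _ _ hu]
  · have hu' : ∀ e, IsUnit (α e * (𝒢.Dstar e).det) := fun e =>
      isUnit_of_dvd_unit
      (Finset.dvd_prod_of_mem (fun e => α e * (𝒢.Dstar e).det) (Finset.mem_univ e)) hu
    have h := sum_mul_prod_erase_mul_inverse
      (fun e => (𝒢.blockD e).cofSum - α e * (𝒢.Dstar e).det) _ hu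
    rw [← hcof, sub_mul, Ring.mul_inverse_cancel _ hu] at h
    rw [h]
    refine Finset.sum_congr rfl fun e _ => ?_
    rw [sub_mul, Ring.mul_inverse_cancel _ (hu' e)]
  · have hκ' : M.det * ((∏ e, α e) * Ring.inverse (∏ e, α e * (𝒢.Dstar e).det)) = 1 := by
      rw [← mul_assoc, hprodM, mul_comm (∏ e : G.StrongBlock, (𝒢.Dstar e).det),
        ← Finset.prod_mul_distrib, Ring.mul_inverse_cancel _ hu]
    rw [Ring.inverse_eq_of_mul_eq_one hκ', hcofG, mul_assoc]
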